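/- Let $t_1,t_2,\dots$ be commuting indeterminates and consider the formal power series over $\mathbb{Q}$ \[ E=\Bigl(\prod_{j\ge 1}\exp(t_{2j-1})\Bigr)\cosh\Bigl(\sum_{j\ge 1}\Bigl(\tfrac{2j-1}{2}\,t_{2j-1}^2+j\,t_{2j}^2\Bigr)\Bigr), \qquad O=\Bigl(\prod_{j\ge 1}\exp(t_{2j-1})\Bigr)\sinh\Bigl(\sum_{j\ge 1}\Bigl(\tfrac{2j-1}{2}\,t_{2j-1}^2+j\,t_{2j}^2\Bigr)\Bigr), \] where the infinite product and the infinite sum converge formally (each coefficient is eventually constant along the finite partial products and sums). Let $\sigma$ be a permutation of $n$ letters with cycle type $\mathbf c=(c_1,\dots,c_n)$, that is, for each $i\in\{1,\dots,n\}$ the permutation $\sigma$ has exactly $c_i$ cycles of length $i$, fixed points being cycles of length $1$ (so $c_1+2c_2+\cdots+nc_n=n$). Then the coefficient of $\dfrac{t_1^{c_1}\cdots t_n^{c_n}}{c_1!\cdots c_n!}$ in $E$ is the number of even permutations $\tau$ of the $n$ letters with $\tau^2=\sigma$, and the coefficient of $\dfrac{t_1^{c_1}\cdots t_n^{c_n}}{c_1!\cdots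 c_n!}$ in $O$ is the number of odd permutations $\tau$ of the $n$ letters with $\tau^2=\sigma$. -/

import Mathlib

open scoped Nat

/-- Formal power series over `ℚ` in the variables `t ℓ`; only the `t ℓ` with `1 ≤ ℓ` occur below. -/
abbrev Series : Type := MvPowerSeries ℕ ℚ

/-- Formal convergence: every coefficient is eventually constant, that is, the topology of
coefficientwise convergence for the discrete topology on `ℚ`. -/
@[reducible] noncomputable def formalTopology : TopologicalSpace Series :=
  letI : TopologicalSpace ℚ := ⊥
  MvPowerSeries.WithPiTopology.instTopologicalSpace ℚ

attribute [local instance] formalTopology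

/-- The variable `t_ℓ`. -/
noncomputable def t (ℓ : ℕ) : Series := MvPowerSeries.X ℓ

/-- The power series of `cosh`. -/
noncomputable def coshSeries : PowerSeries ℚ :=
  PowerSeries.mk fun m => if Even m then 1 / (m ! : ℚ) else 0

/-- The power series of `sinh`. -/
noncomputable def sinhSeries : PowerSeries ℚ :=
  PowerSeries.mk fun m => if Odd m then 1 / (m ! : ℚ) else 0

/-- `exp (t_{2j-1})` for `j ≥ 1`, with `j - 1` as the index. -/
noncomputable def expFactor (j : ℕ) : Series :=
  (PowerSeries.exp ℚ).subst (t (2 * j + 1))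

/-- `(2j-1)/2 * t_{2j-1}^2 + j * t_{2j}^2` for `j ≥ 1`, with `j - 1` as the index. -/
noncomputable def squareTerm (j : ℕ) : Series :=
  ((2 * (j : ℚ) + 1) / 2) • t (2 * j + 1) ^ 2 + ((j : ℚ) + 1) • t (2 * j + 2) ^ 2

/-- `∏_{j ≥ 1} exp (t_{2j-1}) * cosh (∑_{j ≥ 1} ((2j-1)/2 * t_{2j-1}^2 + j * t_{2j}^2))`. -/
noncomputable def evenRootSeries : Series :=
  (∏' j, expFactor j) * coshSeries.subst (∑' j, squareTerm j)

/-- `∏_{j ≥ 1} exp (t_{2j-1}) * sinh (∑_{j ≥ 1} ((2j-1)/2 * t_{2j-1}^2 + j * t_{2j}^2))`. -/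
noncomputable def oddRootSeries : Series :=
  (∏' j, expFactor j) * sinhSeries.subst (∑' j, squareTerm j)

/-- The coefficient of `t_1^{c_1} ⋯ t_n^{c_n} / (c_1! ⋯ c_n!)` in `F`, where `c_{i+1}` is `c i`. -/
noncomputable def egfCoeff {n : ℕ} (c : Fin n → ℕ) (F : Series) : ℚ :=
  (∏ i, ((c i)! : ℚ)) *
    MvPowerSeries.coeff (∑ i : Fin n, Finsupp.single ((i : ℕ) + 1) (c i)) F

/-- `σ` has exactly `c i` cycles of length `i + 1` for every `i`, where fixed points are cycles of
length `1` (`Equiv.Perm.partition` counts them, `Equiv.Perm.cycleType` does not). -/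
def HasCycleVector {n : ℕ} (σ : Equiv.Perm (Fin n)) (c : Fin n → ℕ) : Prop :=
  ∀ i : Fin n, σ.partition.parts.count ((i : ℕ) + 1) = c i

/-- The even square roots of `σ`. -/
def evenSquareRoots {n : ℕ} (σ : Equiv.Perm (Fin n)) : Finset (Equiv.Perm (Fin n)) :=
  {τ | τ ^ 2 = σ ∧ Equiv.Perm.sign τ = 1}

/-- The odd square roots of `σ`. -/
def oddSquareRoots {n : ℕ} (σ : Equiv.Perm (Fin n)) : Finset (Equiv.Perm (Fin n)) :=
  {τ | τ ^ 2 = σ ∧ Equiv.Perm.sign τ = -1}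

/-! Let `F u` be `evenRootSeries` for `u = 1` and `oddRootSeries` for `u = -1`. As the derivative of
`cosh` is `sinh` and vice versa, these series satisfy
`∂ F u / ∂ t_i = [i odd] F u + i t_i F (-u)`, which is a recurrence for their coefficients.

The square roots `τ` of sign `u` of `σ` obey the same recurrence. Fix a point `a` on a cycle of `σ`
of length `i`, and sort the roots by `τ a`. If `τ a` is on the cycle of `a`, then `i` is odd and `τ`
is on that cycle the power `(i + 1) / 2` of `σ`, an even permutation. Otherwise `τ a` is any point
of another cycle of length `i`, and `τ` interleaves the two cycles into one of length `2 i`, an odd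
permutation. In both cases `τ` restricts to an arbitrary square root of the rest of `σ`. -/

section Cycles

open Equiv Equiv.Perm Finset Function

variable {α : Type*}

theorem minimalPeriod_perm_pos [Finite α] (σ : Perm α) (a : α) : 0 < minimalPeriod σ a :=
  minimalPeriod_pos_of_mem_periodicPts (σ.injective.mem_periodicPts a)

theorem pow_apply_eq_pow_apply_iff_modEq (σ : Perm α) (a : α) (m n : ℕ) :
    (σ ^ m) a = (σ ^ n) a ↔ m ≡ n [MOD minimalPeriod σ a] := by
  have period_dvd_iff (k : ℤ) : (σ ^ k) a = a ↔ (minimalPeriod σ a : ℤ) ∣ k :=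
    MulAction.zpow_smul_eq_iff_minimalPeriod_dvd (a := σ) (b := a)
  rw [← Int.natCast_modEq_iff, Int.modEq_iff_dvd, ← period_dvd_iff, sub_eq_neg_add, zpow_add,
    zpow_neg, zpow_natCast, zpow_natCast, Perm.mul_apply, inv_eq_iff_eq, eq_comm]

theorem injective_pow_fin_apply (σ : Perm α) (a : α) :
    Injective fun k : Fin (minimalPeriod σ a) => (σ ^ (k : ℕ)) a := fun k l hkl =>
  Fin.ext (((pow_apply_eq_pow_apply_iff_modEq σ a k l).1 hkl).eq_of_lt_of_lt k.2 l.2)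

theorem sameCycle_iff_exists_fin [Finite α] (σ : Perm α) (a x : α) :
    σ.SameCycle a x ↔ ∃ k : Fin (minimalPeriod σ a), (σ ^ (k : ℕ)) a = x := by
  constructor
  · intro h
    obtain ⟨k, rfl⟩ := h.exists_nat_pow_eq
    exact ⟨⟨k % minimalPeriod σ a, Nat.mod_lt _ (minimalPeriod_perm_pos σ a)⟩,
      (pow_apply_eq_pow_apply_iff_modEq σ a _ _).2 (Nat.mod_modEq _ _)⟩
  · rintro ⟨k, rfl⟩
    exact sameCycle_pow_right.2 (SameCycle.refl σ a)

theorem card_sameCycle [Fintype α] [DecidableEq α] (σ : Perm α) (a : α) :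
    #{x | σ.SameCycle a x} = minimalPeriod σ a := by
  have image_eq : ({x | σ.SameCycle a x} : Finset α) =
      univ.image fun k : Fin (minimalPeriod σ a) => (σ ^ (k : ℕ)) a := by
    ext x
    simp [sameCycle_iff_exists_fin]
  rw [image_eq, card_image_of_injective _ (injective_pow_fin_apply σ a), card_fin]

theorem minimalPeriod_apply_of_commute {σ τ : Perm α} (h : Commute τ σ) (x : α) :
    minimalPeriod σ (τ x) = minimalPeriod σ x := by
  have semiconj : Semiconj τ σ σ := fun y => Perm.congr_fun h.eq y
  refine minimalPeriod_eq_minimalPeriod_iff.2 fun n => ?_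
  rw [IsPeriodicPt, IsFixedPt, ← (semiconj.iterate_right n).eq, τ.injective.eq_iff]
  rfl

theorem minimalPeriod_eq_of_sameCycle {σ : Perm α} {a x : α} (h : σ.SameCycle a x) :
    minimalPeriod σ x = minimalPeriod σ a := by
  obtain ⟨k, rfl⟩ := h
  exact minimalPeriod_apply_of_commute ((Commute.refl σ).zpow_left k) a

theorem minimalPeriod_subtypePerm {σ : Perm α} {p : α → Prop} (h : ∀ x, p (σ x) ↔ p x)
    (x : {x // p x}) : minimalPeriod (σ.subtypePerm h) x = minimalPeriod σ x := by
  refine minimalPeriod_eq_minimalPeriod_iff.2 fun n => ?_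
  simp only [IsPeriodicPt, IsFixedPt, iterate_eq_pow, subtypePerm_pow, Subtype.ext_iff,
    subtypePerm_apply]

theorem eq_of_semiconj_of_sameCycle [Finite α] {β : Type*} {f g : α → β} {σ : Perm α}
    {s : β → β} (hf : Semiconj f σ s) (hg : Semiconj g σ s) {x y : α} (hxy : σ.SameCycle x y)
    (hx : f x = g x) : f y = g y := by
  obtain ⟨k, rfl⟩ := hxy.exists_nat_pow_eq
  rw [← iterate_eq_pow, (hf.iterate_right k).eq, (hg.iterate_right k).eq, hx]

end Cycles

section CycleCounts

open Equiv Equiv.Perm Finset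
open Function (minimalPeriod IsFixedPt minimalPeriod_eq_one_iff_isFixedPt)

theorem card_filter_minimalPeriod_subtypePerm {α : Type*} [Fintype α] {σ : Perm α} {p : α → Prop}
    [DecidablePred p] (hp : ∀ x, p (σ x) ↔ p x) (m : ℕ) :
    #{x | minimalPeriod (σ.subtypePerm hp) x = m} = #{x | minimalPeriod σ x = m ∧ p x} := by
  rw [← card_map (Function.Embedding.subtype p)]
  congr 1
  ext x
  simp [minimalPeriod_subtypePerm, and_comm]

variable {α : Type*} [Fintype α] [DecidableEq α]

/-- The number of cycles of each length of a permutation, fixed points being cycles of length `1`,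
as the exponent vector of the monomial attached to it. -/
noncomputable def cycleCounts (σ : Perm α) : ℕ →₀ ℕ :=
  Multiset.toFinsupp σ.partition.parts

theorem cycleCounts_zero (σ : Perm α) : cycleCounts σ 0 = 0 := by
  rw [cycleCounts, Multiset.toFinsupp_apply, Multiset.count_eq_zero]
  exact fun h => (σ.partition.parts_pos h).false

theorem cycleCounts_eq_zero_of_card_lt (σ : Perm α) {m : ℕ} (hm : Fintype.card α < m) :
    cycleCounts σ m = 0 := by
  rw [cycleCounts, Multiset.toFinsupp_apply, Multiset.count_eq_zero]
  exact fun h => hm.not_ge (σ.partition.parts_sum ▸ Multiset.le_sum_of_mem h)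

theorem card_support_cycleOf {σ : Perm α} {x : α} (hx : σ x ≠ x) :
    #(σ.cycleOf x).support = minimalPeriod σ x := by
  rw [← card_sameCycle]
  congr 1
  ext y
  simp [mem_support_cycleOf_iff' hx]

theorem filter_support_minimalPeriod_eq_biUnion (σ : Perm α) (m : ℕ) :
    {x ∈ σ.support | minimalPeriod σ x = m} =
      {c ∈ σ.cycleFactorsFinset | m = #c.support}.biUnion support := by
  ext x
  simp only [mem_filter, mem_biUnion, mem_support]
  constructor
  · rintro ⟨hx, rfl⟩
    exact ⟨σ.cycleOf x, ⟨cycleOf_mem_cycleFactorsFinset_iff.2 (mem_support.2 hx),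
      (card_support_cycleOf hx).symm⟩, by rwa [cycleOf_apply_self]⟩
  · rintro ⟨c, ⟨hc, rfl⟩, hxc⟩
    have hx : σ x ≠ x := mem_support.1 (mem_cycleFactorsFinset_support_le hc (mem_support.2 hxc))
    rw [cycle_is_cycleOf (mem_support.2 hxc) hc]
    exact ⟨hx, (card_support_cycleOf hx).symm⟩

theorem mul_count_cycleType (σ : Perm α) (m : ℕ) :
    m * σ.cycleType.count m = #{x ∈ σ.support | minimalPeriod σ x = m} := by
  rw [filter_support_minimalPeriod_eq_biUnion, card_biUnion, sum_const_nat (m := m), cycleType_def,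
    Multiset.count_map, mul_comm]
  · rfl
  · exact fun c hc => (mem_filter.1 hc).2.symm
  · intro c hc d hd hcd
    exact disjoint_iff_disjoint_support.1 (cycleFactorsFinset_pairwise_disjoint σ
      (mem_filter.1 hc).1 (mem_filter.1 hd).1 hcd)

theorem mul_cycleCounts (σ : Perm α) (m : ℕ) :
    m * cycleCounts σ m = #{x | minimalPeriod σ x = m} := by
  have fixed_iff (x : α) : x ∈ σ.supportᶜ ↔ minimalPeriod σ x = 1 := by
    rw [mem_compl, notMem_support, minimalPeriod_eq_one_iff_isFixedPt, IsFixedPt]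
  have card_fixed : #{x ∈ σ.supportᶜ | minimalPeriod σ x = m} =
      m * (Multiset.replicate (Fintype.card α - #σ.support) 1).count m := by
    rw [Multiset.count_replicate, ← card_compl]
    split_ifs with hm
    · rw [filter_true_of_mem fun x hx => ((fixed_iff x).1 hx).trans hm, ← hm, one_mul]
    · rw [filter_false_of_mem fun x hx h => hm (((fixed_iff x).1 hx).symm.trans h), card_empty,
        mul_zero]
  rw [cycleCounts, Multiset.toFinsupp_apply, parts_partition, Multiset.count_add, mul_add,
    mul_count_cycleType, ← card_fixed, ← card_union_of_disjoint
      (disjoint_filter_filter disjoint_compl_right), ← filter_union, union_compl]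

theorem cycleCounts_eq_of_forall_mul_eq {σ : Perm α} {d : ℕ →₀ ℕ} (h0 : d 0 = 0)
    (h : ∀ m, m * d m = #{x | minimalPeriod σ x = m}) : cycleCounts σ = d := by
  ext m
  rcases m.eq_zero_or_pos with rfl | hm
  · rw [cycleCounts_zero, h0]
  · exact Nat.eq_of_mul_eq_mul_left hm ((mul_cycleCounts σ m).trans (h m).symm)

theorem cycleCounts_of_isEmpty [IsEmpty α] (σ : Perm α) : cycleCounts σ = 0 :=
  cycleCounts_eq_of_forall_mul_eq rfl fun m => by simp

theorem cycleCounts_of_forall_minimalPeriod_eq {σ : Perm α} {i k : ℕ} (hi : i ≠ 0)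
    (h : ∀ x, minimalPeriod σ x = i) (hcard : Fintype.card α = i * k) :
    cycleCounts σ = Finsupp.single i k := by
  refine cycleCounts_eq_of_forall_mul_eq (Finsupp.single_eq_of_ne hi.symm) fun m => ?_
  rcases eq_or_ne m i with rfl | hm
  · simp [h, hcard]
  · simp [h, hm, hm.symm]

theorem cycleCounts_eq_add_subtypePerm {σ : Perm α} {p : α → Prop} [DecidablePred p]
    (hp : ∀ x, p (σ x) ↔ p x) :
    cycleCounts σ = cycleCounts (σ.subtypePerm hp) +
      cycleCounts (σ.subtypePerm (p := fun x => ¬p x) fun x => not_congr (hp x)) := by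
  refine cycleCounts_eq_of_forall_mul_eq (by simp [cycleCounts_zero]) fun m => ?_
  rw [Finsupp.add_apply, mul_add, mul_cycleCounts, mul_cycleCounts,
    card_filter_minimalPeriod_subtypePerm, card_filter_minimalPeriod_subtypePerm, ← filter_filter,
    ← filter_filter, card_filter_add_card_filter_not]

end CycleCounts

section Interleaving

open Equiv Equiv.Perm
open Function (minimalPeriod)

/-- The square root of two disjoint copies of `π` that interleaves them: the copy `false` is
identified with the copy `true`, and that one with the copy `false` through `π`. -/
def crossingRoot {β : Type*} (π : Perm β) : Perm (β × Bool) :=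
  prodCongrLeft (fun c => bif c then 1 else π) * prodCongrRight fun _ => swap false true

theorem crossingRoot_apply_false {β : Type*} (π : Perm β) (x : β) :
    crossingRoot π (x, false) = (x, true) := rfl

theorem crossingRoot_sq {β : Type*} (π : Perm β) :
    crossingRoot π ^ 2 = prodCongrLeft fun _ => π := by
  ext1 ⟨x, c⟩
  cases c <;> rfl

theorem sign_crossingRoot {β : Type*} [Fintype β] [DecidableEq β] (π : Perm β) :
    sign (crossingRoot π) = (-1) ^ Fintype.card β * sign π := by
  simp [crossingRoot, sign_prodCongrLeft, sign_prodCongrRight, mul_comm]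

theorem coe_finRotate_modEq (n : ℕ) (k : Fin n) : (finRotate n k : ℕ) ≡ k + 1 [MOD n] := by
  have : NeZero n := ⟨k.pos.ne'⟩
  rw [finRotate_apply, Fin.val_add, Fin.val_one', Nat.add_mod_mod]
  exact Nat.mod_modEq _ _

theorem pow_finRotate_minimalPeriod_apply {α : Type*} (σ : Perm α) (a : α)
    (k : Fin (minimalPeriod σ a)) : (σ ^ (finRotate _ k : ℕ)) a = σ ((σ ^ (k : ℕ)) a) := by
  rw [← Perm.mul_apply, ← pow_succ', pow_apply_eq_pow_apply_iff_modEq]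
  exact coe_finRotate_modEq _ k

theorem exists_equiv_fin_minimalPeriod_prod_bool {α : Type*} [Finite α] {σ : Perm α} {a b : α}
    (hab : ¬σ.SameCycle a b) (hper : minimalPeriod σ b = minimalPeriod σ a)
    (hcover : ∀ x, σ.SameCycle a x ∨ σ.SameCycle b x) :
    ∃ e : Fin (minimalPeriod σ a) × Bool ≃ α,
      ∀ k c, e (k, c) = (σ ^ (k : ℕ)) (bif c then b else a) := by
  let f (q : Fin (minimalPeriod σ a) × Bool) : α := (σ ^ (q.1 : ℕ)) (bif q.2 then b else a)
  have apply_ne (k l : ℕ) : (σ ^ k) a ≠ (σ ^ l) b := fun h =>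
    have sameCycle : σ.SameCycle a ((σ ^ l) b) := h ▸ sameCycle_pow_right.2 (SameCycle.refl σ a)
    hab (sameCycle_pow_right.1 sameCycle)
  have injective_f : Function.Injective f := by
    rintro ⟨k, c⟩ ⟨l, d⟩ h
    cases c <;> cases d
    · exact congrArg (·, false) (injective_pow_fin_apply σ a h)
    · exact absurd h (apply_ne k l)
    · exact absurd h.symm (apply_ne l k)
    · have modEq := (pow_apply_eq_pow_apply_iff_modEq σ b k l).1 h
      rw [hper] at modEq
      exact congrArg (·, true) (Fin.ext (modEq.eq_of_lt_of_lt k.2 l.2))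
  have surjective_f : Function.Surjective f := fun x => by
    rcases hcover x with h | h
    · obtain ⟨k, hk⟩ := (sameCycle_iff_exists_fin σ a x).1 h
      exact ⟨(k, false), hk⟩
    · obtain ⟨k, hk⟩ := (sameCycle_iff_exists_fin σ b x).1 h
      exact ⟨(k.cast hper, true), hk⟩
  exact ⟨Equiv.ofBijective f ⟨injective_f, surjective_f⟩, fun _ _ => rfl⟩

theorem exists_odd_sq_eq_of_not_sameCycle {α : Type*} [Fintype α] [DecidableEq α] {σ : Perm α}
    {a b : α} (hab : ¬σ.SameCycle a b) (hper : minimalPeriod σ b = minimalPeriod σ a)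
    (hcover : ∀ x, σ.SameCycle a x ∨ σ.SameCycle b x) :
    ∃ ρ : Perm α, ρ ^ 2 = σ ∧ ρ a = b ∧ sign ρ = -1 := by
  obtain ⟨e, he⟩ := exists_equiv_fin_minimalPeriod_prod_bool hab hper hcover
  have pos : 0 < minimalPeriod σ a := minimalPeriod_perm_pos σ a
  have permCongr_finRotate : e.permCongr (prodCongrLeft fun _ => finRotate _) = σ := by
    ext x
    obtain ⟨⟨k, c⟩, rfl⟩ := e.surjective x
    rw [permCongr_apply, symm_apply_apply, prodCongrLeft_apply, he, he]
    cases c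
    · exact pow_finRotate_minimalPeriod_apply σ a k
    · rw [← Perm.mul_apply, ← pow_succ', pow_apply_eq_pow_apply_iff_modEq]
      exact hper.symm ▸ coe_finRotate_modEq _ k
  refine ⟨e.permCongr (crossingRoot (finRotate _)), ?_, ?_, ?_⟩
  · rw [pow_two, ← permCongr_mul, ← pow_two, crossingRoot_sq, permCongr_finRotate]
  · have apply_zero_false : e (⟨0, pos⟩, false) = a := he _ false
    have apply_zero_true : e (⟨0, pos⟩, true) = b := he _ true
    rw [permCongr_apply, e.symm_apply_eq.2 apply_zero_false.symm, crossingRoot_apply_false,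
      apply_zero_true]
  · rw [sign_permCongr, sign_crossingRoot, Fintype.card_fin, sign_finRotate, ← pow_add,
      show minimalPeriod σ a + (minimalPeriod σ a - 1) = 2 * (minimalPeriod σ a - 1) + 1 by omega,
      pow_succ, pow_mul]
    simp

end Interleaving

section SubtypeCongr

open Equiv Equiv.Perm

variable {α : Type*} {p : α → Prop} [DecidablePred p]

theorem subtypeCongr_pow (ρ : Perm {x // p x}) (τ : Perm {x // ¬p x}) (n : ℕ) :
    ρ.subtypeCongr τ ^ n = (ρ ^ n).subtypeCongr (τ ^ n) :=
  (map_pow (subtypeCongrHom p) (ρ, τ) n).symm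

theorem subtypeCongr_subtypePerm {σ : Perm α} (hp : ∀ x, p (σ x) ↔ p x) :
    (σ.subtypePerm hp).subtypeCongr (σ.subtypePerm fun x => not_congr (hp x)) = σ := by
  ext x
  rw [subtypeCongr.apply]
  split_ifs <;> rfl

theorem exists_subtypeCongr_eq {ρ : Perm {x // p x}} {τ : Perm α}
    (h : ∀ x : {x // p x}, τ x = ρ x) : ∃ τ', ρ.subtypeCongr τ' = τ := by
  have invariant (x : α) : p (τ x) ↔ p x := by
    refine ⟨fun hx => ?_, fun hx => h ⟨x, hx⟩ ▸ (ρ ⟨x, hx⟩).2⟩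
    obtain ⟨y, hy⟩ := ρ.surjective ⟨τ x, hx⟩
    have eq_x : (y : α) = x := τ.injective ((h y).trans (congrArg Subtype.val hy))
    exact eq_x ▸ y.2
  have restrict_eq : τ.subtypePerm invariant = ρ := by
    ext x
    exact h x
  exact ⟨τ.subtypePerm fun x => not_congr (invariant x),
    restrict_eq ▸ subtypeCongr_subtypePerm invariant⟩

end SubtypeCongr

section SquareRoots

open Equiv Equiv.Perm Finset
open Function (minimalPeriod Semiconj)

variable {α : Type*}

theorem pow_succ_sq_of_forall_minimalPeriod_eq {σ : Perm α} {m : ℕ}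
    (h : ∀ x, minimalPeriod σ x = 2 * m + 1) : (σ ^ (m + 1)) ^ 2 = σ := by
  ext x
  rw [← pow_mul, show (m + 1) * 2 = 1 + (2 * m + 1) by ring]
  refine ((pow_apply_eq_pow_apply_iff_modEq σ x _ 1).2 ?_).trans (by rw [pow_one])
  rw [h]
  exact Nat.add_modEq_right

theorem commute_of_sq_eq {τ σ : Perm α} (h : τ ^ 2 = σ) : Commute τ σ :=
  h ▸ (Commute.refl τ).pow_right 2

theorem minimalPeriod_odd_and_apply_eq_pow_of_sq_eq [Finite α] {σ τ : Perm α} (hτ : τ ^ 2 = σ)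
    {a : α} (h : σ.SameCycle a (τ a)) :
    ∃ m, minimalPeriod σ a = 2 * m + 1 ∧ τ a = (σ ^ (m + 1)) a := by
  obtain ⟨k, hk⟩ := h.exists_nat_pow_eq
  have two_mul_modEq : 2 * k ≡ 1 [MOD minimalPeriod σ a] := by
    rw [← pow_apply_eq_pow_apply_iff_modEq, two_mul, pow_add, Perm.mul_apply, hk,
      ← Perm.mul_apply, ← ((commute_of_sq_eq hτ).pow_right k).eq, Perm.mul_apply, hk,
      ← Perm.mul_apply, ← pow_two, hτ, pow_one]
  obtain ⟨m, hm⟩ : Odd (minimalPeriod σ a) := by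
    refine Nat.not_even_iff_odd.1 fun even => ?_
    simpa [Nat.ModEq] using two_mul_modEq.of_dvd even.two_dvd
  refine ⟨m, hm, ?_⟩
  rw [← hk, pow_apply_eq_pow_apply_iff_modEq]
  rw [hm] at two_mul_modEq ⊢
  refine Nat.ModEq.cancel_left_of_coprime (c := 2) (by simp) (two_mul_modEq.trans ?_)
  rw [show 2 * (m + 1) = 1 + (2 * m + 1) by ring]
  exact Nat.add_modEq_right.symm

variable [Fintype α] [DecidableEq α]

/-- The square roots of `σ` of sign `u`: the even ones for `u = 1`, the odd ones for `u = -1`. -/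
def signedSquareRoots (σ : Perm α) (u : ℤˣ) : Finset (Perm α) :=
  {τ | τ ^ 2 = σ ∧ sign τ = u}

theorem mem_signedSquareRoots {σ τ : Perm α} {u : ℤˣ} :
    τ ∈ signedSquareRoots σ u ↔ τ ^ 2 = σ ∧ sign τ = u := by
  simp [signedSquareRoots]

theorem card_signedSquareRoots_of_isEmpty [IsEmpty α] (σ : Perm α) (u : ℤˣ) :
    #(signedSquareRoots σ u) = if u = 1 then 1 else 0 := by
  have sq_eq (τ : Perm α) : τ ^ 2 = σ := Subsingleton.elim _ _
  have sign_eq (τ : Perm α) : sign τ = 1 := by rw [Subsingleton.elim τ 1, Perm.sign_one]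
  split_ifs with hu <;> simp [signedSquareRoots, sq_eq, sign_eq, eq_comm, hu]

theorem subtypeCongr_mem_signedSquareRoots_iff {σ : Perm α} {p : α → Prop} [DecidablePred p]
    (hp : ∀ x, p (σ x) ↔ p x) {ρ : Perm {x // p x}} (hρ : ρ ^ 2 = σ.subtypePerm hp)
    (τ : Perm {x // ¬p x}) (u : ℤˣ) :
    ρ.subtypeCongr τ ∈ signedSquareRoots σ u ↔
      τ ∈ signedSquareRoots (σ.subtypePerm (p := fun x => ¬p x) fun x => not_congr (hp x))
        (sign ρ * u) := by
  have sq_eq_iff : ρ.subtypeCongr τ ^ 2 = σ ↔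
      τ ^ 2 = σ.subtypePerm (p := fun x => ¬p x) fun x => not_congr (hp x) := by
    rw [subtypeCongr_pow, hρ]
    nth_rewrite 2 [← subtypeCongr_subtypePerm hp]
    exact (subtypeCongrHom_injective p).eq_iff.trans Prod.mk_right_inj
  have sign_eq_iff : sign (ρ.subtypeCongr τ) = u ↔ sign τ = sign ρ * u := by
    rw [sign_subtypeCongr, ← eq_inv_mul_iff_mul_eq, Int.units_inv_eq_self]
  rw [mem_signedSquareRoots, mem_signedSquareRoots, sq_eq_iff, sign_eq_iff]

theorem card_filter_signedSquareRoots_extending {σ : Perm α} {p : α → Prop} [DecidablePred p]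
    (hp : ∀ x, p (σ x) ↔ p x) {ρ : Perm {x // p x}} (hρ : ρ ^ 2 = σ.subtypePerm hp) (u : ℤˣ) :
    #{τ ∈ signedSquareRoots σ u | ∀ x : {x // p x}, τ x = (ρ x : α)} =
      #(signedSquareRoots (σ.subtypePerm (p := fun x => ¬p x) fun x => not_congr (hp x))
        (sign ρ * u)) := by
  symm
  refine card_bij (fun τ _ => ρ.subtypeCongr τ) (fun τ hτ => ?_) (fun τ _ τ' _ h => ?_)
    fun τ hτ => ?_
  · exact mem_filter.2 ⟨(subtypeCongr_mem_signedSquareRoots_iff hp hρ τ u).2 hτ,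
      subtypeCongr.left_apply_subtype ρ τ⟩
  · exact congrArg Prod.snd (@subtypeCongrHom_injective _ p _ (ρ, τ) (ρ, τ') h)
  · obtain ⟨τ', rfl⟩ := exists_subtypeCongr_eq (mem_filter.1 hτ).2
    exact ⟨τ', (subtypeCongr_mem_signedSquareRoots_iff hp hρ τ' u).1 (mem_filter.1 hτ).1, rfl⟩

theorem card_filter_signedSquareRoots_apply_eq {σ : Perm α} {p : α → Prop} [DecidablePred p]
    (hp : ∀ x, p (σ x) ↔ p x) {ρ : Perm {x // p x}} (hρ : ρ ^ 2 = σ.subtypePerm hp)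
    {a : {x // p x}} (hcover : ∀ x : {x // p x}, σ.SameCycle a x ∨ σ.SameCycle (ρ a) x) (u : ℤˣ) :
    #{τ ∈ signedSquareRoots σ u | τ a = (ρ a : α)} =
      #(signedSquareRoots (σ.subtypePerm (p := fun x => ¬p x) fun x => not_congr (hp x))
        (sign ρ * u)) := by
  rw [← card_filter_signedSquareRoots_extending hp hρ]
  congr 1
  refine filter_congr fun τ hτ => ⟨fun apply_a x => ?_, fun h => h a⟩
  have hsq : τ ^ 2 = σ := (mem_signedSquareRoots.1 hτ).1
  have semiconj_τ : Semiconj (fun x : {x // p x} => τ x) (σ.subtypePerm hp) σ := fun x =>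
    Perm.congr_fun (commute_of_sq_eq hsq).eq x
  have semiconj_ρ : Semiconj (fun x : {x // p x} => (ρ x : α)) (σ.subtypePerm hp) σ := fun x =>
    congrArg Subtype.val (Perm.congr_fun (commute_of_sq_eq hρ).eq x)
  have apply_ρ_a : τ (ρ a) = ρ (ρ a) := by
    have sq_apply : ρ (ρ a) = σ.subtypePerm hp a := Perm.congr_fun hρ a
    rw [sq_apply, ← apply_a, ← Perm.mul_apply, ← pow_two, hsq, subtypePerm_apply]
  rcases hcover x with h | h
  · exact eq_of_semiconj_of_sameCycle semiconj_τ semiconj_ρ (sameCycle_subtypePerm.2 h) apply_a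
  · exact eq_of_semiconj_of_sameCycle semiconj_τ semiconj_ρ (sameCycle_subtypePerm.2 h) apply_ρ_a

/-- The permutation induced by `σ` outside the cycle of `a`: what is left to find a root of once a
root is known to preserve that cycle. -/
def withoutCycle (σ : Perm α) (a : α) : Perm {x // ¬σ.SameCycle a x} :=
  σ.subtypePerm fun _ => not_congr sameCycle_apply_right

/-- The permutation induced by `σ` outside the cycles of `a` and `b`: what is left to find a root of
once a root is known to exchange these cycles. -/
def withoutCycles (σ : Perm α) (a b : α) : Perm {x // ¬(σ.SameCycle a x ∨ σ.SameCycle b x)} :=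
  σ.subtypePerm fun _ => not_congr (or_congr sameCycle_apply_right sameCycle_apply_right)

theorem cycleCounts_eq_withoutCycle_add (σ : Perm α) (a : α) :
    cycleCounts σ = cycleCounts (withoutCycle σ a) + Finsupp.single (minimalPeriod σ a) 1 := by
  rw [cycleCounts_eq_add_subtypePerm fun x => sameCycle_apply_right (x := a), add_comm]
  congr 1
  refine cycleCounts_of_forall_minimalPeriod_eq (minimalPeriod_perm_pos σ a).ne' (fun x => ?_) ?_
  · rw [minimalPeriod_subtypePerm, minimalPeriod_eq_of_sameCycle x.2]
  · rw [Fintype.card_subtype, card_sameCycle, mul_one]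

theorem cycleCounts_eq_withoutCycles_add {σ : Perm α} {a b : α} (hab : ¬σ.SameCycle a b)
    (hper : minimalPeriod σ b = minimalPeriod σ a) :
    cycleCounts σ = cycleCounts (withoutCycles σ a b) + Finsupp.single (minimalPeriod σ a) 2 := by
  rw [cycleCounts_eq_add_subtypePerm (p := fun x => σ.SameCycle a x ∨ σ.SameCycle b x)
    fun x => or_congr sameCycle_apply_right sameCycle_apply_right, add_comm]
  congr 1
  refine cycleCounts_of_forall_minimalPeriod_eq (minimalPeriod_perm_pos σ a).ne' (fun x => ?_) ?_
  · rw [minimalPeriod_subtypePerm]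
    exact x.2.elim minimalPeriod_eq_of_sameCycle fun h =>
      (minimalPeriod_eq_of_sameCycle h).trans hper
  · have disjoint_cycles : _root_.Disjoint ({x | σ.SameCycle a x} : Finset α)
        ({x | σ.SameCycle b x} : Finset α) :=
      disjoint_filter.2 fun x _ hax hbx => hab (hax.trans hbx.symm)
    rw [Fintype.card_subtype, filter_or, card_union_of_disjoint disjoint_cycles, card_sameCycle,
      card_sameCycle, hper, mul_two]

theorem card_filter_signedSquareRoots_apply_eq_pow {σ : Perm α} {a : α} {m : ℕ}
    (hm : minimalPeriod σ a = 2 * m + 1) (u : ℤˣ) :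
    #{τ ∈ signedSquareRoots σ u | τ a = (σ ^ (m + 1)) a} =
      #(signedSquareRoots (withoutCycle σ a) u) := by
  have invariant (x : α) : σ.SameCycle a (σ x) ↔ σ.SameCycle a x := sameCycle_apply_right
  set ρ := σ.subtypePerm invariant ^ (m + 1) with hρ
  have sq_eq : ρ ^ 2 = σ.subtypePerm invariant :=
    pow_succ_sq_of_forall_minimalPeriod_eq fun x => by
      rw [minimalPeriod_subtypePerm, minimalPeriod_eq_of_sameCycle x.2, hm]
  have sign_eq : sign ρ = 1 := by
    rw [hρ, map_pow, ← sq_eq, map_pow, Int.units_sq, one_pow]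
  have apply_eq : (ρ ⟨a, SameCycle.refl σ a⟩ : α) = (σ ^ (m + 1)) a := by
    rw [hρ, subtypePerm_pow, subtypePerm_apply]
  have fiber := card_filter_signedSquareRoots_apply_eq invariant sq_eq
    (a := ⟨a, SameCycle.refl σ a⟩) (fun x => Or.inl x.2) u
  rwa [apply_eq, sign_eq, one_mul] at fiber

theorem card_filter_signedSquareRoots_apply_eq_of_not_sameCycle {σ : Perm α} {a b : α}
    (hab : ¬σ.SameCycle a b) (hper : minimalPeriod σ b = minimalPeriod σ a) (u : ℤˣ) :
    #{τ ∈ signedSquareRoots σ u | τ a = b} = #(signedSquareRoots (withoutCycles σ a b) (-u)) := by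
  have invariant (x : α) : (σ.SameCycle a (σ x) ∨ σ.SameCycle b (σ x)) ↔
      (σ.SameCycle a x ∨ σ.SameCycle b x) :=
    or_congr sameCycle_apply_right sameCycle_apply_right
  let a' : {x // σ.SameCycle a x ∨ σ.SameCycle b x} := ⟨a, Or.inl (SameCycle.refl σ a)⟩
  let b' : {x // σ.SameCycle a x ∨ σ.SameCycle b x} := ⟨b, Or.inr (SameCycle.refl σ b)⟩
  obtain ⟨ρ, sq_eq, apply_eq, sign_eq⟩ :
      ∃ ρ, ρ ^ 2 = σ.subtypePerm invariant ∧ ρ a' = b' ∧ sign ρ = -1 := by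
    refine exists_odd_sq_eq_of_not_sameCycle (mt sameCycle_subtypePerm.1 hab) ?_ fun x =>
      x.2.imp sameCycle_subtypePerm.2 sameCycle_subtypePerm.2
    rwa [minimalPeriod_subtypePerm, minimalPeriod_subtypePerm]
  have fiber := card_filter_signedSquareRoots_apply_eq invariant sq_eq (a := a')
    (fun x => apply_eq ▸ x.2) u
  rwa [apply_eq, sign_eq, neg_one_mul] at fiber

theorem sum_card_filter_signedSquareRoots_sameCycle (σ : Perm α) (u : ℤˣ) (a : α) :
    ∑ b with σ.SameCycle a b, #{τ ∈ signedSquareRoots σ u | τ a = b} =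
      if Odd (minimalPeriod σ a) then #(signedSquareRoots (withoutCycle σ a) u) else 0 := by
  have fiber_eq_empty {b : α} (hb : σ.SameCycle a b)
      (h : ∀ m, minimalPeriod σ a = 2 * m + 1 → b ≠ (σ ^ (m + 1)) a) :
      #{τ ∈ signedSquareRoots σ u | τ a = b} = 0 := by
    rw [card_eq_zero, filter_eq_empty_iff]
    rintro τ hτ rfl
    obtain ⟨m, hm, apply_a⟩ :=
      minimalPeriod_odd_and_apply_eq_pow_of_sq_eq (mem_signedSquareRoots.1 hτ).1 hb
    exact h m hm apply_a
  split_ifs with hodd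
  · obtain ⟨m, hm⟩ := hodd
    rw [← card_filter_signedSquareRoots_apply_eq_pow hm u]
    have mem : (σ ^ (m + 1)) a ∈ ({b | σ.SameCycle a b} : Finset α) :=
      mem_filter.2 ⟨mem_univ _, sameCycle_pow_right.2 (SameCycle.refl σ a)⟩
    refine sum_eq_single_of_mem _ mem fun b hb hne =>
      fiber_eq_empty (mem_filter.1 hb).2 fun m' hm' => ?_
    rwa [show m' = m by omega]
  · exact sum_eq_zero fun b hb => fiber_eq_empty (mem_filter.1 hb).2 fun m hm =>
      absurd ⟨m, hm⟩ hodd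

theorem card_filter_signedSquareRoots_apply_eq_of_minimalPeriod_ne {σ : Perm α} {a b : α}
    (hper : minimalPeriod σ b ≠ minimalPeriod σ a) (u : ℤˣ) :
    #{τ ∈ signedSquareRoots σ u | τ a = b} = 0 := by
  rw [card_eq_zero, filter_eq_empty_iff]
  rintro τ hτ rfl
  exact hper (minimalPeriod_apply_of_commute (commute_of_sq_eq (mem_signedSquareRoots.1 hτ).1) a)

theorem card_signedSquareRoots_eq_sum (σ : Perm α) (u : ℤˣ) (a : α) :
    #(signedSquareRoots σ u) =
      (if Odd (minimalPeriod σ a) then #(signedSquareRoots (withoutCycle σ a) u) else 0) +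
        ∑ b with ¬σ.SameCycle a b ∧ minimalPeriod σ b = minimalPeriod σ a,
          #(signedSquareRoots (withoutCycles σ a b) (-u)) := by
  rw [card_eq_sum_card_fiberwise (f := fun τ => τ a) (t := univ) (by simp [Set.MapsTo]),
    ← sum_filter_add_sum_filter_not _ fun b => σ.SameCycle a b,
    sum_card_filter_signedSquareRoots_sameCycle]
  congr 1
  rw [← filter_filter, sum_filter (p := fun b => minimalPeriod σ b = minimalPeriod σ a)]
  refine sum_congr rfl fun b hb => ?_
  split_ifs with hper
  · exact card_filter_signedSquareRoots_apply_eq_of_not_sameCycle (mem_filter.1 hb).2 hper u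
  · exact card_filter_signedSquareRoots_apply_eq_of_minimalPeriod_ne hper u

theorem mul_cycleCounts_withoutCycle (σ : Perm α) (a : α) (i : ℕ) :
    i * cycleCounts (withoutCycle σ a) i = #{x | ¬σ.SameCycle a x ∧ minimalPeriod σ x = i} := by
  rw [mul_cycleCounts, withoutCycle, card_filter_minimalPeriod_subtypePerm]
  simp only [and_comm]

end SquareRoots

section FormalDerivatives

open Filter
open scoped MvPowerSeries.WithPiTopology PowerSeries.WithPiTopology

variable {τ R : Type*}

theorem continuous_pderiv [CommSemiring R] [TopologicalSpace R] [ContinuousMul R] (i : τ) :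
    Continuous (MvPowerSeries.pderiv R i) :=
  continuous_pi fun d =>
    ((continuous_mul_const ((d i : R) + 1)).comp
      (MvPowerSeries.WithPiTopology.continuous_coeff R (d + Finsupp.single i 1))).congr
        fun f => (MvPowerSeries.coeff_pderiv f d).symm

theorem continuous_derivative [CommSemiring R] [TopologicalSpace R] [ContinuousMul R] :
    Continuous (PowerSeries.derivative R) :=
  continuous_pderiv ()

theorem continuous_powerSeries_subst [CommRing R] [TopologicalSpace R] [IsTopologicalSemiring R]
    {a : MvPowerSeries τ R} (ha : PowerSeries.HasSubst a) :
    Continuous fun f : PowerSeries R => f.subst a := by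
  refine continuous_pi fun d => ?_
  have finite_support : {m : ℕ | MvPowerSeries.coeff d (a ^ m) ≠ 0}.Finite := by
    simpa [Function.HasFiniteSupport, Function.support] using
      PowerSeries.coeff_subst_finite ha (PowerSeries.mk fun _ => (1 : R)) d
  have coeff_eq (f : PowerSeries R) : MvPowerSeries.coeff d (f.subst a) =
      ∑ m ∈ finite_support.toFinset, PowerSeries.coeff m f * MvPowerSeries.coeff d (a ^ m) := by
    rw [PowerSeries.coeff_subst ha]
    refine finsum_eq_sum_of_support_subset _ fun m hm => ?_
    rw [Set.Finite.coe_toFinset]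
    exact right_ne_zero_of_smul hm
  refine Continuous.congr ?_ fun f => (coeff_eq f).symm
  exact continuous_finsetSum _ fun m _ =>
    (PowerSeries.WithPiTopology.continuous_coeff R m).mul continuous_const

theorem pderiv_polynomial_subst [CommRing R] {a : MvPowerSeries τ R} (ha : PowerSeries.HasSubst a)
    (p : Polynomial R) (i : τ) :
    MvPowerSeries.pderiv R i ((p : PowerSeries R).subst a) =
      (PowerSeries.derivative R (p : PowerSeries R)).subst a * MvPowerSeries.pderiv R i a := by
  simp only [PowerSeries.subst_coe ha, PowerSeries.derivative_coe,
    Derivation.comp_aeval_eq (a := a) (MvPowerSeries.pderiv R i) p, smul_eq_mul]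

theorem pderiv_subst [CommRing R] {a : MvPowerSeries τ R} (ha : PowerSeries.HasSubst a)
    (f : PowerSeries R) (i : τ) :
    MvPowerSeries.pderiv R i (f.subst a) =
      (PowerSeries.derivative R f).subst a * MvPowerSeries.pderiv R i a := by
  let : TopologicalSpace R := ⊥
  have : DiscreteTopology R := ⟨rfl⟩
  -- Both sides are continuous in `f`, and polynomials are dense among the power series.
  exact congrFun ((PowerSeries.WithPiTopology.denseRange_toPowerSeries R).equalizer
    ((continuous_pderiv i).comp (continuous_powerSeries_subst ha))
    (((continuous_powerSeries_subst ha).comp continuous_derivative).mul continuous_const)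
    (funext fun p => pderiv_polynomial_subst ha p i)) f

theorem constantCoeff_subst_of_constantCoeff_eq_zero [CommRing R] {a : MvPowerSeries τ R}
    (ha : MvPowerSeries.constantCoeff a = 0) (f : PowerSeries R) :
    MvPowerSeries.constantCoeff (f.subst a) = PowerSeries.constantCoeff f := by
  rw [PowerSeries.constantCoeff_subst (PowerSeries.HasSubst.of_constantCoeff_zero ha),
    finsum_eq_single _ 0 fun m hm => by rw [map_pow, ha, zero_pow hm, smul_zero]]
  simp

theorem derivation_prod_eq_sum_mul_prod {ι A : Type*} [CommSemiring R] [CommSemiring A]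
    [Algebra R A] (D : Derivation R A A) {f g : ι → A} (hD : ∀ j, D (f j) = g j * f j)
    (s : Finset ι) : D (∏ j ∈ s, f j) = (∑ j ∈ s, g j) * ∏ j ∈ s, f j := by
  classical
  induction s using Finset.induction_on with
  | empty => simp
  | insert k s hk ih =>
    rw [Finset.prod_insert hk, Finset.sum_insert hk, Derivation.leibniz, ih, hD, smul_eq_mul,
      smul_eq_mul]
    ring

theorem derivation_eq_mul_of_hasSum_of_hasProd {ι A : Type*} [CommSemiring R] [CommSemiring A]
    [Algebra R A] [TopologicalSpace A] [T2Space A] [ContinuousMul A] {D : Derivation R A A}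
    (continuous_D : Continuous D) {f g : ι → A} {F G : A} (hD : ∀ j, D (f j) = g j * f j)
    (hg : HasSum g G) (hf : HasProd f F) : D F = G * F := by
  refine tendsto_nhds_unique ((continuous_D.tendsto F).comp hf) ?_
  refine (Tendsto.mul hg hf).congr fun s => ?_
  exact (derivation_prod_eq_sum_mul_prod D hD s).symm

end FormalDerivatives

section ExpCoeff

open Finsupp (single)

variable {τ R : Type*} [CommSemiring R]

/-- The coefficient of `∏ X_i ^ d_i / d_i!` in a power series, as a linear map; differentiation
shifts it. -/
noncomputable def expCoeff (d : τ →₀ ℕ) : MvPowerSeries τ R →ₗ[R] R :=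
  (d.prod fun _ k => (k ! : R)) • MvPowerSeries.coeff d

theorem expCoeff_apply (d : τ →₀ ℕ) (F : MvPowerSeries τ R) :
    expCoeff d F = (d.prod fun _ k => (k ! : R)) * MvPowerSeries.coeff d F := rfl

theorem expCoeff_zero (F : MvPowerSeries τ R) :
    expCoeff 0 F = MvPowerSeries.constantCoeff F := by
  simp [expCoeff_apply]

theorem prod_factorial_add_single (d : τ →₀ ℕ) (i : τ) :
    ((d + single i 1).prod fun _ k => (k ! : R)) =
      (d.prod fun _ k => (k ! : R)) * (d i + 1) := by
  have split_off (e : τ →₀ ℕ) : (e.prod fun _ k => (k ! : R)) =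
      ((e i)! : R) * ((e.erase i).prod fun _ k => (k ! : R)) :=
    (Finsupp.mul_prod_erase' e i _ (by simp)).symm
  rw [split_off, split_off d, Finsupp.erase_add, Finsupp.erase_single, add_zero,
    Finsupp.add_apply, Finsupp.single_eq_same, Nat.factorial_succ]
  push_cast
  ring

theorem expCoeff_pderiv (d : τ →₀ ℕ) (i : τ) (F : MvPowerSeries τ R) :
    expCoeff d (MvPowerSeries.pderiv R i F) = expCoeff (d + single i 1) F := by
  rw [expCoeff_apply, expCoeff_apply, MvPowerSeries.coeff_pderiv, prod_factorial_add_single]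
  ring

theorem expCoeff_X_mul (d : τ →₀ ℕ) (i : τ) (F : MvPowerSeries τ R) :
    expCoeff d (MvPowerSeries.X i * F) = d i * expCoeff (d - single i 1) F := by
  classical
  rcases eq_or_ne (d i) 0 with h | h
  · have not_le : ¬single i 1 ≤ d := by simp [h]
    rw [expCoeff_apply, MvPowerSeries.X, MvPowerSeries.coeff_monomial_mul, if_neg not_le, h]
    simp
  · obtain ⟨e, rfl⟩ : ∃ e, d = e + single i 1 :=
      ⟨d - single i 1, (tsub_add_cancel_of_le (by simpa using Nat.one_le_iff_ne_zero.2 h)).symm⟩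
    rw [expCoeff_apply, mul_comm (MvPowerSeries.X i), MvPowerSeries.X,
      MvPowerSeries.coeff_add_mul_monomial, prod_factorial_add_single, add_tsub_cancel_right,
      expCoeff_apply, Finsupp.add_apply, Finsupp.single_eq_same]
    push_cast
    ring

end ExpCoeff

section RootSeries

open Filter Topology
open scoped MvPowerSeries.WithPiTopology

instance : T2Space Series :=
  letI : TopologicalSpace ℚ := ⊥
  haveI : DiscreteTopology ℚ := ⟨rfl⟩
  MvPowerSeries.WithPiTopology.instT2Space

instance : IsTopologicalRing Series :=
  letI : TopologicalSpace ℚ := ⊥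
  haveI : DiscreteTopology ℚ := ⟨rfl⟩
  MvPowerSeries.WithPiTopology.instIsTopologicalRing ℕ ℚ

theorem continuous_pderiv_series (i : ℕ) :
    Continuous (MvPowerSeries.pderiv ℚ i : Series → Series) :=
  let : TopologicalSpace ℚ := ⊥
  have : DiscreteTopology ℚ := ⟨rfl⟩
  continuous_pderiv i

theorem tendsto_weightedOrder_of_le {f : ℕ → Series}
    (h : ∀ j : ℕ, (j : ℕ∞) ≤ (f j).weightedOrder id) :
    Tendsto (fun j => (f j).weightedOrder id) atTop (𝓝 ⊤) :=
  tendsto_nhds_top_mono' ENat.tendsto_natCast_nhds_top h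

theorem weightedOrder_t (ℓ : ℕ) : (t ℓ).weightedOrder id = ℓ := by
  rw [t, MvPowerSeries.X, MvPowerSeries.weightedOrder_monomial_of_ne_zero _ one_ne_zero]
  simp [Finsupp.weight_single]

theorem constantCoeff_t (ℓ : ℕ) : MvPowerSeries.constantCoeff (t ℓ) = 0 :=
  MvPowerSeries.constantCoeff_X ℓ

theorem hasSubst_t (ℓ : ℕ) : PowerSeries.HasSubst (t ℓ) :=
  PowerSeries.HasSubst.X ℓ

theorem le_weightedOrder_expFactor_sub_one (j : ℕ) :
    (j : ℕ∞) ≤ (expFactor j - 1).weightedOrder id := by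
  have eq_subst : expFactor j - 1 = (PowerSeries.exp ℚ - 1).subst (t (2 * j + 1)) := by
    rw [PowerSeries.subst_sub (hasSubst_t _), expFactor, ← map_one (PowerSeries.substAlgHom
      (R := ℚ) (hasSubst_t (2 * j + 1))), PowerSeries.coe_substAlgHom]
  have one_le_order : 1 ≤ (PowerSeries.exp ℚ - 1).order :=
    PowerSeries.one_le_order_iff_constCoeff_eq_zero.2 (by simp)
  calc (j : ℕ∞) ≤ ((2 * j + 1 : ℕ) : ℕ∞) := by exact_mod_cast (by omega)
    _ = 1 * (t (2 * j + 1)).weightedOrder id := by rw [weightedOrder_t, one_mul]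
    _ ≤ _ := mul_le_mul_left one_le_order _
    _ ≤ _ := PowerSeries.le_weightedOrder_subst id (hasSubst_t _) _
    _ = _ := by rw [eq_subst]

theorem le_weightedOrder_smul_t_sq {j ℓ : ℕ} (h : j ≤ ℓ) (r : ℚ) :
    (j : ℕ∞) ≤ (r • t ℓ ^ 2).weightedOrder id :=
  calc (j : ℕ∞) ≤ ((2 * ℓ : ℕ) : ℕ∞) := by exact_mod_cast (by omega)
    _ = 2 • (t ℓ).weightedOrder id := by rw [weightedOrder_t]; simp
    _ ≤ (t ℓ ^ 2).weightedOrder id := MvPowerSeries.le_weightedOrder_pow id 2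
    _ ≤ _ := MvPowerSeries.le_weightedOrder_smul id

theorem multipliable_expFactor : Multipliable expFactor := by
  let : TopologicalSpace ℚ := ⊥
  simpa only [add_sub_cancel] using
    MvPowerSeries.WithPiTopology.multipliable_one_add_of_tendsto_weightedOrder_atTop_nhds_top
      (tendsto_weightedOrder_of_le le_weightedOrder_expFactor_sub_one)

theorem summable_squareTerm : Summable squareTerm := by
  let : TopologicalSpace ℚ := ⊥
  refine MvPowerSeries.WithPiTopology.summable_of_tendsto_weightedOrder_atTop_nhds_top
    (w := id) (tendsto_weightedOrder_of_le fun j => ?_)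
  exact (le_min (le_weightedOrder_smul_t_sq (by omega) _)
    (le_weightedOrder_smul_t_sq (by omega) _)).trans (MvPowerSeries.min_weightedOrder_le_add id)

theorem constantCoeff_tprod_expFactor : MvPowerSeries.constantCoeff (∏' j, expFactor j) = 1 := by
  let : TopologicalSpace ℚ := ⊥
  have : DiscreteTopology ℚ := ⟨rfl⟩
  have constantCoeff_expFactor (j : ℕ) : MvPowerSeries.constantCoeff (expFactor j) = 1 := by
    rw [expFactor, constantCoeff_subst_of_constantCoeff_eq_zero (constantCoeff_t _),
      PowerSeries.constantCoeff_exp]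
  rw [multipliable_expFactor.map_tprod _ (MvPowerSeries.WithPiTopology.continuous_constantCoeff ℚ)]
  simp only [constantCoeff_expFactor, tprod_one]

theorem constantCoeff_tsum_squareTerm : MvPowerSeries.constantCoeff (∑' j, squareTerm j) = 0 := by
  let : TopologicalSpace ℚ := ⊥
  have : DiscreteTopology ℚ := ⟨rfl⟩
  have constantCoeff_squareTerm (j : ℕ) : MvPowerSeries.constantCoeff (squareTerm j) = 0 := by
    simp [squareTerm, constantCoeff_t]
  rw [summable_squareTerm.map_tsum _ (MvPowerSeries.WithPiTopology.continuous_constantCoeff ℚ)]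
  simp only [constantCoeff_squareTerm, tsum_zero]

theorem hasSubst_tsum_squareTerm : PowerSeries.HasSubst (∑' j, squareTerm j) :=
  PowerSeries.HasSubst.of_constantCoeff_zero constantCoeff_tsum_squareTerm

theorem pderiv_t (i ℓ : ℕ) : MvPowerSeries.pderiv ℚ i (t ℓ) = if ℓ = i then 1 else 0 := by
  rw [t, MvPowerSeries.pderiv_X, Pi.single_apply]

theorem pderiv_expFactor (i j : ℕ) :
    MvPowerSeries.pderiv ℚ i (expFactor j) = (if 2 * j + 1 = i then 1 else 0) * expFactor j := by
  rw [expFactor, pderiv_subst (hasSubst_t _), PowerSeries.derivative_exp, pderiv_t, mul_comm]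

theorem pderiv_squareTerm (i j : ℕ) :
    MvPowerSeries.pderiv ℚ i (squareTerm j) = if j = (i - 1) / 2 then (i : ℚ) • t i else 0 := by
  have pderiv_smul_t_sq (r : ℚ) (ℓ : ℕ) :
      MvPowerSeries.pderiv ℚ i (r • t ℓ ^ 2) = if ℓ = i then (2 * r) • t i else 0 := by
    rw [Derivation.map_smul, MvPowerSeries.pderiv_pow, pderiv_t]
    split_ifs with h
    · rw [h, MvPowerSeries.smul_eq_C_mul, MvPowerSeries.smul_eq_C_mul, map_mul, map_ofNat]
      push_cast
      ring
    · simp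
  rw [squareTerm, map_add, pderiv_smul_t_sq, pderiv_smul_t_sq]
  rcases eq_or_ne (2 * j + 1) i with rfl | h_odd
  · rw [if_pos rfl, if_neg (by omega), if_pos (by omega), add_zero]
    congr 1
    push_cast
    ring
  rcases eq_or_ne (2 * j + 2) i with rfl | h_even
  · rw [if_neg h_odd, if_pos rfl, if_pos (by omega), zero_add]
    congr 1
    push_cast
    ring
  rw [if_neg h_odd, if_neg h_even, add_zero]
  -- Truncated subtraction makes `(0 - 1) / 2 = 0`, harmless because `i • t i = 0` for `i = 0`.
  split_ifs with hj
  · rw [show i = 0 by omega, Nat.cast_zero, zero_smul]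
  · rfl

theorem pderiv_tprod_expFactor (i : ℕ) :
    MvPowerSeries.pderiv ℚ i (∏' j, expFactor j) =
      (if Odd i then 1 else 0) * ∏' j, expFactor j := by
  refine derivation_eq_mul_of_hasSum_of_hasProd (continuous_pderiv_series i) (pderiv_expFactor i)
    ?_ multipliable_expFactor.hasProd
  split_ifs with hi
  · obtain ⟨k, rfl⟩ := hi
    simpa [eq_comm] using hasSum_ite_eq k (1 : Series)
  · have ne (j : ℕ) : 2 * j + 1 ≠ i := fun h => hi ⟨j, h.symm⟩
    simpa only [if_neg (ne _)] using hasSum_zero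

theorem pderiv_tsum_squareTerm (i : ℕ) :
    MvPowerSeries.pderiv ℚ i (∑' j, squareTerm j) = (i : ℚ) • t i := by
  rw [summable_squareTerm.map_tsum _ (continuous_pderiv_series i)]
  simp only [pderiv_squareTerm, tsum_ite_eq]

theorem derivative_coshSeries : PowerSeries.derivative ℚ coshSeries = sinhSeries := by
  ext m
  simp only [PowerSeries.coeff_derivative, coshSeries, sinhSeries, PowerSeries.coeff_mk,
    Nat.even_add_one, Nat.not_even_iff_odd, Nat.factorial_succ, Nat.cast_mul, Nat.cast_succ]
  split_ifs
  · field_simp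
  · rw [zero_mul]

theorem derivative_sinhSeries : PowerSeries.derivative ℚ sinhSeries = coshSeries := by
  ext m
  simp only [PowerSeries.coeff_derivative, coshSeries, sinhSeries, PowerSeries.coeff_mk,
    Nat.odd_add_one, Nat.not_odd_iff_even, Nat.factorial_succ, Nat.cast_mul, Nat.cast_succ]
  split_ifs
  · field_simp
  · rw [zero_mul]

/-- `cosh` for `u = 1` and `sinh` for `u = -1`, indexed so that differentiation changes the sign of
`u`. -/
noncomputable def hyperbolicSeries (u : ℤˣ) : PowerSeries ℚ :=
  if u = 1 then coshSeries else sinhSeries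

theorem derivative_hyperbolicSeries (u : ℤˣ) :
    PowerSeries.derivative ℚ (hyperbolicSeries u) = hyperbolicSeries (-u) := by
  rcases Int.units_eq_one_or u with rfl | rfl
  · exact derivative_coshSeries
  · exact derivative_sinhSeries

theorem constantCoeff_hyperbolicSeries (u : ℤˣ) :
    PowerSeries.constantCoeff (hyperbolicSeries u) = if u = 1 then 1 else 0 := by
  rw [hyperbolicSeries, ← PowerSeries.coeff_zero_eq_constantCoeff_apply]
  split_ifs <;> simp [coshSeries, sinhSeries]

/-- The generating function of the square roots of sign `u`: `evenRootSeries` for `u = 1` and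
`oddRootSeries` for `u = -1`. -/
noncomputable def rootSeries (u : ℤˣ) : Series :=
  (∏' j, expFactor j) * (hyperbolicSeries u).subst (∑' j, squareTerm j)

theorem rootSeries_one : rootSeries 1 = evenRootSeries := by
  rw [rootSeries, hyperbolicSeries, if_pos rfl, evenRootSeries]

theorem rootSeries_neg_one : rootSeries (-1) = oddRootSeries := by
  rw [rootSeries, hyperbolicSeries, if_neg (by decide), oddRootSeries]

theorem constantCoeff_rootSeries (u : ℤˣ) :
    MvPowerSeries.constantCoeff (rootSeries u) = if u = 1 then 1 else 0 := by
  rw [rootSeries, map_mul, constantCoeff_tprod_expFactor, one_mul,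
    constantCoeff_subst_of_constantCoeff_eq_zero constantCoeff_tsum_squareTerm,
    constantCoeff_hyperbolicSeries]

theorem pderiv_rootSeries (i : ℕ) (u : ℤˣ) :
    MvPowerSeries.pderiv ℚ i (rootSeries u) =
      (if Odd i then 1 else 0) * rootSeries u + (i : ℚ) • (t i * rootSeries (-u)) := by
  rw [rootSeries, Derivation.leibniz, pderiv_tprod_expFactor,
    pderiv_subst hasSubst_tsum_squareTerm, derivative_hyperbolicSeries, pderiv_tsum_squareTerm,
    rootSeries, smul_eq_mul, smul_eq_mul, MvPowerSeries.smul_eq_C_mul, MvPowerSeries.smul_eq_C_mul]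
  ring

theorem expCoeff_rootSeries_add_single (d : ℕ →₀ ℕ) (i : ℕ) (u : ℤˣ) :
    expCoeff (d + Finsupp.single i 1) (rootSeries u) =
      (if Odd i then expCoeff d (rootSeries u) else 0) +
        i * d i * expCoeff (d - Finsupp.single i 1) (rootSeries (-u)) := by
  rw [← expCoeff_pderiv, pderiv_rootSeries, map_add, map_smul, t, expCoeff_X_mul, smul_eq_mul,
    mul_assoc, ite_mul, one_mul, zero_mul, apply_ite (expCoeff d), map_zero]

end RootSeries

section Conclusion

open Equiv Equiv.Perm Finset
open Finsupp (single)
open Function (minimalPeriod)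

theorem card_signedSquareRoots_eq_expCoeff {α : Type*} [Fintype α] [DecidableEq α] (σ : Perm α)
    (u : ℤˣ) : (#(signedSquareRoots σ u) : ℚ) = expCoeff (cycleCounts σ) (rootSeries u) := by
  induction hn : Fintype.card α using Nat.strong_induction_on generalizing α u with
  | _ n ih =>
  subst hn
  rcases isEmpty_or_nonempty α with _ | ⟨⟨a⟩⟩
  · rw [card_signedSquareRoots_of_isEmpty, cycleCounts_of_isEmpty, expCoeff_zero,
      constantCoeff_rootSeries, Nat.cast_ite, Nat.cast_one, Nat.cast_zero]
  have split_one := cycleCounts_eq_withoutCycle_add σ a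
  have card_withoutCycle : (#(signedSquareRoots (withoutCycle σ a) u) : ℚ) =
      expCoeff (cycleCounts (withoutCycle σ a)) (rootSeries u) :=
    ih _ (Fintype.card_subtype_lt (not_not.2 (SameCycle.refl σ a))) _ u rfl
  have card_withoutCycles {b : α} (hab : ¬σ.SameCycle a b)
      (hper : minimalPeriod σ b = minimalPeriod σ a) :
      (#(signedSquareRoots (withoutCycles σ a b) (-u)) : ℚ) =
        expCoeff (cycleCounts (withoutCycle σ a) - single (minimalPeriod σ a) 1)
          (rootSeries (-u)) := by
    have split_two := cycleCounts_eq_withoutCycles_add hab hper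
    rw [split_one, show (2 : ℕ) = 1 + 1 from rfl, Finsupp.single_add, ← add_assoc] at split_two
    rw [add_right_cancel split_two, add_tsub_cancel_right]
    exact ih _ (Fintype.card_subtype_lt (not_not.2 (Or.inl (SameCycle.refl σ a)))) _ (-u) rfl
  rw [card_signedSquareRoots_eq_sum σ u a, split_one, expCoeff_rootSeries_add_single, Nat.cast_add,
    Nat.cast_ite, Nat.cast_zero, card_withoutCycle, Nat.cast_sum, ← Nat.cast_mul,
    mul_cycleCounts_withoutCycle, ← nsmul_eq_mul]
  congr 1
  exact sum_eq_card_nsmul fun b hb =>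
    card_withoutCycles (mem_filter.1 hb).2.1 (mem_filter.1 hb).2.2

theorem sum_single_eq_embDomain {ι τ M : Type*} [Fintype ι] [AddCommMonoid M] (e : ι ↪ τ)
    (c : ι → M) : ∑ i, single (e i) (c i) = (Finsupp.equivFunOnFinite.symm c).embDomain e := by
  rw [Finsupp.embDomain_eq_mapDomain, Finsupp.mapDomain, Finsupp.sum_fintype _ _ (by simp)]
  rfl

theorem egfCoeff_eq_expCoeff {n : ℕ} (c : Fin n → ℕ) (F : Series) :
    egfCoeff c F = expCoeff (∑ i : Fin n, single ((i : ℕ) + 1) (c i)) F := by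
  have exponent_eq := sum_single_eq_embDomain (Fin.valEmbedding.trans (addRightEmbedding 1)) c
  rw [egfCoeff, expCoeff_apply]
  congr 1
  refine Eq.symm ((congrArg (Finsupp.prod · _) exponent_eq).trans ?_)
  rw [Finsupp.prod_embDomain, Finsupp.prod_fintype _ _ (by simp)]
  rfl

theorem sum_single_eq_cycleCounts {n : ℕ} {c : Fin n → ℕ} {σ : Perm (Fin n)}
    (h : HasCycleVector σ c) :
    ∑ i : Fin n, single ((i : ℕ) + 1) (c i) = cycleCounts σ := by
  refine (sum_single_eq_embDomain (Fin.valEmbedding.trans (addRightEmbedding 1)) c).trans ?_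
  ext m
  by_cases hm : ∃ i : Fin n, (i : ℕ) + 1 = m
  · obtain ⟨i, rfl⟩ := hm
    exact (Finsupp.embDomain_apply_self _ _ i).trans (h i).symm
  · rw [Finsupp.embDomain_of_notMem_range _ _ _ hm]
    rcases m with _ | k
    · exact (cycleCounts_zero σ).symm
    · refine (cycleCounts_eq_zero_of_card_lt σ ?_).symm
      rw [Fintype.card_fin, Nat.lt_succ_iff]
      exact not_lt.1 fun hk => hm ⟨⟨k, hk⟩, rfl⟩

theorem egfCoeff_rootSeries {n : ℕ} {c : Fin n → ℕ} {σ : Perm (Fin n)}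
    (h : HasCycleVector σ c) (u : ℤˣ) :
    egfCoeff c (rootSeries u) = #(signedSquareRoots σ u) := by
  rw [egfCoeff_eq_expCoeff, sum_single_eq_cycleCounts h, card_signedSquareRoots_eq_expCoeff]

theorem evenSquareRoots_eq_signedSquareRoots {n : ℕ} (σ : Perm (Fin n)) :
    evenSquareRoots σ = signedSquareRoots σ 1 := rfl

theorem oddSquareRoots_eq_signedSquareRoots {n : ℕ} (σ : Perm (Fin n)) :
    oddSquareRoots σ = signedSquareRoots σ (-1) := rfl

end Conclusion

/-- The infinite product and the infinite sum converge formally, the sum may be substituted into a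
power series, and the resulting series count the even and the odd square roots. -/
theorem mainTheorem3 :
    Multipliable expFactor ∧ Summable squareTerm ∧
    PowerSeries.HasSubst (∑' j, squareTerm j) ∧
    ∀ (n : ℕ) (c : Fin n → ℕ) (σ : Equiv.Perm (Fin n)), HasCycleVector σ c →
      egfCoeff c evenRootSeries = ((evenSquareRoots σ).card : ℚ) ∧
      egfCoeff c oddRootSeries = ((oddSquareRoots σ).card : ℚ) := by
  refine ⟨multipliable_expFactor, summable_squareTerm, hasSubst_tsum_squareTerm,
    fun n c σ h => ⟨?_, ?_⟩⟩
  · rw [← rootSeries_one, evenSquareRoots_eq_signedSquareRoots, egfCoeff_rootSeries h]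
  · rw [← rootSeries_neg_one, oddSquareRoots_eq_signedSquareRoots, egfCoeff_rootSeries h]
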